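/- Let $q\ge 17$ be an odd prime power and let $\mathrm{PG}(2,q)$ be the projective plane over $\mathbb{F}_q$. An arc is a set of points of $\mathrm{PG}(2,q)$ no three of which are collinear; an arc is complete if it is not properly contained in another arc. Let $\mathcal{C}$ be the conic $XY=Z^2$ and let $H=\{(1,s^4,s^2) : s\in\mathbb{F}_q\}$. Let $R_0=(a_0,b_0,0)$ be a point of $\mathrm{PG}(2,q)$ such that $a_0b_0$ is a non-square of $\mathbb{F}_q$ if $q\equiv 1 \pmod 4$, and $a_0\neq 0$ and $b_0/a_0=u^4$ for some $u\in\mathbb{F}_q\setminus\{0\}$ if $q\equiv 3\pmod 4$. Then $H$ is a set of $(q+1)/2$ points of $\mathcal{C}$; the point $R_0$ is an internal point of $\mathcal{C}$ (it is not on $\mathcal{C}$ and lies on no tangent line of $\mathcal{C}$), and every line through $R_0$ that meets $\mathcal{C}$ in two points contains exactly one point of $H$; and the set $K=H\cup\{R_0\}$ is a complete arc of size $(q+3)/2$. -/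

import Mathlib

open scoped LinearAlgebra.Projectivization

namespace PlanarArc

/-- The projective plane `PG(2, F)`: the one-dimensional subspaces of `F³`. -/
abbrev PG2 (F : Type*) [Field F] : Type _ := ℙ F (Fin 3 → F)

/-- A projective subspace of the plane is a line if the underlying vector subspace has
dimension two. -/
def IsLine {F : Type*} [Field F] (l : Projectivization.Subspace F (Fin 3 → F)) : Prop :=
  Module.finrank F l.submodule = 2

/-- An arc: a set of points no three of which are collinear. -/
def IsArc {F : Type*} [Field F] (K : Set (PG2 F)) : Prop :=
  ∀ P ∈ K, ∀ Q ∈ K, ∀ R ∈ K, P ≠ Q → P ≠ R → Q ≠ R →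
    ¬ Projectivization.IsCollinear ({P, Q, R} : Set (PG2 F))

/-- A complete arc: an arc that is not properly contained in another arc. -/
def IsCompleteArc {F : Type*} [Field F] (K : Set (PG2 F)) : Prop :=
  Maximal IsArc K

/-- The conic `XY = Z²`. (The equation is homogeneous, so it holds for one representative of a
point if and only if it holds for all of them.) -/
def conic (F : Type*) [Field F] : Set (PG2 F) :=
  {P | ∃ (v : Fin 3 → F) (hv : v ≠ 0), P = Projectivization.mk F v hv ∧ v 0 * v 1 = v 2 ^ 2}

/-- The point `(1, s⁴, s²)`. -/
def halfConicPoint {F : Type*} [Field F] (s : F) : PG2 F :=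
  Projectivization.mk F ![1, s ^ 4, s ^ 2] (fun h => one_ne_zero (congrFun h 0))

/-- The set `H = {(1, s⁴, s²) : s ∈ F}`. -/
def halfConic (F : Type*) [Field F] : Set (PG2 F) :=
  Set.range (halfConicPoint (F := F))

/-- A tangent line of a point set `C`: a line with exactly one point in `C`. -/
def IsTangentLine {F : Type*} [Field F] (C : Set (PG2 F))
    (l : Projectivization.Subspace F (Fin 3 → F)) : Prop :=
  IsLine l ∧ ((l : Set (PG2 F)) ∩ C).ncard = 1

/-- A secant line of a point set `C`: a line with exactly two points in `C`. -/
def IsSecantLine {F : Type*} [Field F] (C : Set (PG2 F))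
    (l : Projectivization.Subspace F (Fin 3 → F)) : Prop :=
  IsLine l ∧ ((l : Set (PG2 F)) ∩ C).ncard = 2

/-- An internal point of `C`: a point outside `C` that lies on no tangent line of `C`. -/
def IsInternalPoint {F : Type*} [Field F] (C : Set (PG2 F)) (P : PG2 F) : Prop :=
  P ∉ C ∧ ∀ l : Projectivization.Subspace F (Fin 3 → F), IsTangentLine C l → P ∉ l

end PlanarArc

/-! Scaling turns `R₀` into `(1, b, 0)`, and both hypotheses say that `-b` is a non-square. Write
the conic as the points `(1, t², t)` together with `(0, 1, 0)`; then `H` consists of those with `t`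
a square. Two conic points `t`, `s` are collinear with `R₀` exactly when `t s = -b`, so each such
pair has one square and one non-square; the line `Z = 0` pairs `0` with `(0, 1, 0)`. This gives the
internal point, the secant count and the arc property.

For completeness, `(x, y, z)` lies on the chord `t`, `s` when `x t s + y = z (t + s)`. The main case
is `exists_isSquare_pair`, with `x = 1` and `y`, `z` nonzero: `s` is the image of `t` under an
involution. If it never matched two distinct squares, counting would force a cubic to take only
non-square values away from its exceptional points (`quadraticChar_cubic_eq_neg_one`). Multiplying
the cubic by its pullback under a Möbius map leaves a quadratic up to squares, whose character sum
is explicit and contradicts `q ≥ 17`; no Weil bound is needed. -/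

namespace PlanarArc

open Finset

/-! ### Quadratic character sums and chords between square parameters -/

section CharacterSums

variable {F : Type*} [Field F] [Fintype F] [DecidableEq F]

theorem sum_quadraticChar_mul_linear (hF : ringChar F ≠ 2) {a d : F} (hd : d ≠ 0) :
    ∑ t : F, quadraticChar F (t * (a * t + d)) = -quadraticChar F a := by
  -- Since `0⁻¹ = 0`, the map `a + d * t⁻¹` permutes `F` and sends `0` to `a`; the correction
  -- removes that spurious term.
  have hterm : ∀ t : F, quadraticChar F (t * (a * t + d)) =
      quadraticChar F (a + d * t⁻¹) - if t = 0 then quadraticChar F a else 0 := by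
    intro t
    by_cases ht : t = 0
    · simp [ht]
    · have : t * (a * t + d) = t ^ 2 * (a + d * t⁻¹) := by field_simp
      rw [this, map_mul, quadraticChar_sq_one' ht]
      simp [ht]
  have hbij : Function.Bijective fun t : F => a + d * t⁻¹ := by
    apply Finite.injective_iff_bijective.mp
    intro t s h
    simpa [hd] using h
  simp_rw [hterm]
  rw [sum_sub_distrib, hbij.sum_comp (fun t => quadraticChar F t), quadraticChar_sum_zero hF]
  simp

theorem quadraticChar_cases (a : F) :
    quadraticChar F a = 0 ∨ quadraticChar F a = 1 ∨ quadraticChar F a = -1 := by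
  by_cases ha : a = 0
  · simp [ha]
  · exact Or.inr (quadraticChar_dichotomy ha)

theorem quadraticChar_le_one (a : F) : quadraticChar F a ≤ 1 := by
  rcases quadraticChar_cases a with h | h | h <;> rw [h] <;> norm_num

theorem neg_one_le_quadraticChar (a : F) : -1 ≤ quadraticChar F a := by
  rcases quadraticChar_cases a with h | h | h <;> rw [h] <;> norm_num

theorem isSquare_of_quadraticChar_eq_one {a : F} (h : quadraticChar F a = 1) : IsSquare a := by
  refine (quadraticChar_one_iff_isSquare ?_).1 h
  rintro rfl
  simp at h

theorem quadraticChar_div (a b : F) :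
    quadraticChar F (a / b) = quadraticChar F (a * b) := by
  by_cases hb : b = 0
  · simp [hb]
  · have : a * b = a / b * b ^ 2 := by field_simp
    rw [this, map_mul, quadraticChar_sq_one' hb, mul_one]

theorem card_quadratic_roots_le (a b c : F) (ha : a ≠ 0) :
    #{t : F | a * t ^ 2 + b * t + c = 0} ≤ 2 := by
  open Polynomial in
  have hdeg := natDegree_quadratic (b := b) (c := c) ha
  have hne : (C a * X ^ 2 + C b * X + C c : F[X]) ≠ 0 := by
    intro h
    rw [h] at hdeg
    simp at hdeg
  refine le_trans ?_ (hdeg ▸ card_roots' (C a * X ^ 2 + C b * X + C c : F[X]))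
  refine le_trans (card_le_card ?_) (Multiset.toFinset_card_le _)
  intro t ht
  simpa [hne] using ht

/-- Every nonzero element is a sum of two distinct nonzero squares. -/
theorem exists_isSquare_add_eq (hF : ringChar F ≠ 2) (hcard : 17 ≤ Fintype.card F) {y : F}
    (hy : y ≠ 0) :
    ∃ t s : F, IsSquare t ∧ IsSquare s ∧ t ≠ 0 ∧ s ≠ 0 ∧ t ≠ s ∧ t + s = y := by
  by_contra! hbad
  set χ := quadraticChar F
  have h2 : (2 : F) ≠ 0 := Ring.two_ne_zero hF
  -- The three exceptions are `t = 0`, `s = 0` and `t = s`. Each contributes at most 4, while the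
  -- full sum is `q - χ(-1) ≥ 16`.
  have hterm : ∀ t ∉ ({0, y, y / 2} : Finset F), (1 + χ t) * (1 + χ (y - t)) = 0 := by
    intro t ht
    simp only [mem_insert, mem_singleton, not_or] at ht
    obtain ⟨h0, h1, h3⟩ := ht
    by_contra hne
    rw [mul_eq_zero, not_or] at hne
    have hs : y - t ≠ 0 := sub_ne_zero.2 (Ne.symm h1)
    have ha : χ t = 1 := (quadraticChar_dichotomy h0).resolve_right fun h => hne.1 (by rw [h]; rfl)
    have hb : χ (y - t) = 1 :=
      (quadraticChar_dichotomy hs).resolve_right fun h => hne.2 (by rw [h]; rfl)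
    refine hbad t (y - t) (isSquare_of_quadraticChar_eq_one ha)
      (isSquare_of_quadraticChar_eq_one hb) h0 hs (fun h => h3 ?_) (by ring)
    field_simp
    linear_combination h
  have hle : ∑ t : F, (1 + χ t) * (1 + χ (y - t)) ≤ 12 := by
    rw [← sum_subset (subset_univ ({0, y, y / 2} : Finset F)) fun t _ ht => hterm t ht]
    refine (sum_le_card_nsmul _ _ 4 fun t _ => ?_).trans ?_
    · nlinarith [quadraticChar_le_one t, quadraticChar_le_one (y - t),
        neg_one_le_quadraticChar t, neg_one_le_quadraticChar (y - t)]
    · have := card_le_three (a := (0 : F)) (b := y) (c := y / 2)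
      simp only [nsmul_eq_mul]
      have : ((#{0, y, y / 2} : ℕ) : ℤ) ≤ 3 := by exact_mod_cast this
      linarith
  have hsum : ∑ t : F, (1 + χ t) * (1 + χ (y - t)) = Fintype.card F - χ (-1) := by
    have h1 : ∀ t, (1 + χ t) * (1 + χ (y - t)) = 1 + χ t + χ (y - t) + χ (t * (-1 * t + y)) := by
      intro t
      rw [map_mul, show -1 * t + y = y - t by ring]
      ring
    have hsub : ∑ t, χ (y - t) = 0 := by
      rw [← quadraticChar_sum_zero hF]
      exact (Equiv.subLeft y).sum_comp fun t => χ t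
    simp_rw [h1, sum_add_distrib]
    rw [sum_quadraticChar_mul_linear hF hy, quadraticChar_sum_zero hF,
      hsub]
    simp only [sum_const, card_univ, nsmul_eq_mul, mul_one, add_zero]
    rfl
  have := quadraticChar_le_one (F := F) (-1)
  have : (17 : ℤ) ≤ Fintype.card F := by exact_mod_cast hcard
  linarith

/-- If no two distinct squares are interchanged by the involution `t ↦ (z t - y) / (t - z)`, then
this involution reverses the quadratic character wherever that makes sense. -/
theorem quadraticChar_cubic_eq_neg_one (hF : ringChar F ≠ 2) {y z : F} (hy : y ≠ 0) (hz : z ≠ 0)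
    (hyz : y ≠ z ^ 2)
    (hbad : ∀ t s : F, IsSquare t → IsSquare s → t ≠ s → t * s + y ≠ z * (t + s)) {t : F}
    (ht0 : t ≠ 0) (hty : z * t ≠ y) (htz : t ≠ z) (htf : t ^ 2 - 2 * z * t + y ≠ 0) :
    quadraticChar F (t * (z * t - y) * (t - z)) = -1 := by
  set χ := quadraticChar F
  have h2 : (2 : F) ≠ 0 := Ring.two_ne_zero hF
  set φ : F → F := fun t => (z * t - y) / (t - z) with hφ
  -- `G` drops the zero and pole of `φ`, their partners `0` and `∞`, and the fixed points, so `φ`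
  -- acts on `G` without fixed points.
  set G : Finset F := {t | t ≠ 0 ∧ z * t ≠ y ∧ t ≠ z ∧ t ^ 2 - 2 * z * t + y ≠ 0} with hG
  have hmem : ∀ t, t ∈ G ↔ t ≠ 0 ∧ z * t ≠ y ∧ t ≠ z ∧ t ^ 2 - 2 * z * t + y ≠ 0 := by simp [hG]
  have hφz : ∀ t, t ≠ z → φ t - z = (z ^ 2 - y) / (t - z) := by
    intro t h
    have := sub_ne_zero.2 h
    simp only [hφ]
    field_simp
    ring
  have hyz' : z ^ 2 - y ≠ 0 := sub_ne_zero.2 hyz.symm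
  have hφG : ∀ t ∈ G, φ t ∈ G := by
    intro t ht
    rw [hmem] at ht ⊢
    obtain ⟨h0, h1, h3, h4⟩ := ht
    have h3' := sub_ne_zero.2 h3
    refine ⟨div_ne_zero (sub_ne_zero.2 h1) h3', ?_, ?_, ?_⟩
    · intro h
      have : z * φ t - y = t * (z ^ 2 - y) / (t - z) := by
        simp only [hφ]
        field_simp
        ring
      rw [h, sub_self, eq_comm] at this
      exact div_ne_zero (mul_ne_zero h0 hyz') h3' this
    · rw [← sub_ne_zero, hφz t h3]
      exact div_ne_zero hyz' h3'
    · have : φ t ^ 2 - 2 * z * φ t + y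
          = -(z ^ 2 - y) * (t ^ 2 - 2 * z * t + y) / (t - z) ^ 2 := by
        simp only [hφ]
        field_simp
        ring
      rw [this]
      exact div_ne_zero (mul_ne_zero (neg_ne_zero.2 hyz') h4) (pow_ne_zero 2 h3')
  have hφφ : ∀ t ∈ G, φ (φ t) = t := by
    intro t ht
    have h3 := ((hmem t).1 ht).2.2.1
    have h3' := sub_ne_zero.2 h3
    have : φ (φ t) = (z * φ t - y) / (φ t - z) := rfl
    rw [this, hφz t h3, div_div_eq_mul_div, div_eq_iff hyz']
    simp only [hφ]
    field_simp
    ring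
  -- The involution interchanges `0` and `y / z`, so `y / z` cannot be a square.
  have hχyz : χ (y * z) = -1 := by
    by_contra h
    have h1 := (quadraticChar_dichotomy (mul_ne_zero hy hz)).resolve_right h
    refine hbad 0 (y / z) (IsSquare.zero) (isSquare_of_quadraticChar_eq_one ?_)
      (div_ne_zero hy hz).symm (by field_simp; ring)
    rwa [quadraticChar_div]
  have hplus : ∀ t ∈ G, (1 + χ t) * (1 + χ (φ t)) = 0 := by
    intro t ht
    have htG := (hmem t).1 ht
    have hsG := (hmem _).1 (hφG t ht)
    by_contra hne
    rw [mul_eq_zero, not_or] at hne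
    have ha : χ t = 1 :=
      (quadraticChar_dichotomy htG.1).resolve_right fun h => hne.1 (by rw [h]; rfl)
    have hb : χ (φ t) = 1 :=
      (quadraticChar_dichotomy hsG.1).resolve_right fun h => hne.2 (by rw [h]; rfl)
    have h3' := sub_ne_zero.2 htG.2.2.1
    have hmul : φ t * (t - z) = z * t - y := div_mul_cancel₀ _ h3'
    refine hbad t (φ t) (isSquare_of_quadraticChar_eq_one ha)
      (isSquare_of_quadraticChar_eq_one hb) (fun h => htG.2.2.2 ?_) ?_
    · rw [← h] at hmul
      linear_combination hmul
    · linear_combination hmul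
  have hsumφ : ∑ t ∈ G, χ (φ t) = ∑ t ∈ G, χ t :=
    sum_nbij' φ φ hφG hφG hφφ hφφ fun _ _ => rfl
  have hcompl : ∑ t ∈ Gᶜ, χ t ≤ 0 := by
    have hzy : z ≠ y / z := by
      rw [Ne, eq_div_iff hz]
      exact fun h => hyz (by rw [← h]; ring)
    have h0y : 0 ≠ y / z := (div_ne_zero hy hz).symm
    have hχ : χ (y / z) = -1 := by rw [quadraticChar_div, hχyz]
    by_cases hfix : ∃ p : F, p ^ 2 - 2 * z * p + y = 0
    · obtain ⟨p, hp⟩ := hfix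
      have hroot : ∀ r : F, r ^ 2 - 2 * z * r + y = 0 → 0 ≠ r ∧ z ≠ r ∧ y / z ≠ r := by
        intro r hr
        have hrz : z ≠ r := by
          rintro rfl
          exact hyz (by linear_combination hr)
        refine ⟨?_, hrz, fun h => ?_⟩
        · rintro rfl
          exact hy (by linear_combination hr)
        · rw [div_eq_iff hz] at h
          have : (r - z) * r = 0 := by linear_combination hr - h
          rcases mul_eq_zero.1 this with h' | h'
          · exact hrz (by linear_combination -h')
          · exact hy (by rw [h, h', zero_mul])
      have hp' : (2 * z - p) ^ 2 - 2 * z * (2 * z - p) + y = 0 := by linear_combination hp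
      obtain ⟨a1, a2, a3⟩ := hroot p hp
      obtain ⟨b1, b2, b3⟩ := hroot _ hp'
      have hpp : p ≠ 2 * z - p := by
        intro h
        have : 2 * (z - p) = 0 := by linear_combination -h
        rcases mul_eq_zero.1 this with h' | h'
        · exact h2 h'
        · exact a2 (by linear_combination h')
      have hGc : Gᶜ = {0, z, y / z, p, 2 * z - p} := by
        ext r
        simp only [mem_compl, hmem, mem_insert, mem_singleton, eq_div_iff hz]
        have : r ^ 2 - 2 * z * r + y = 0 ↔ r = p ∨ r = 2 * z - p := by
          rw [← sub_eq_zero (b := p), ← sub_eq_zero (b := 2 * z - p), ← mul_eq_zero]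
          constructor <;> intro h
          · linear_combination h - hp
          · linear_combination h + hp
        rw [mul_comm r z, ← this]
        tauto
      -- The fixed points have product `y`. An odd number of these three signs is negative, so they
      -- sum to at most 1, which `χ (y / z) = -1` cancels.
      have hprod : χ p * χ (2 * z - p) * χ z = -1 := by
        rw [← map_mul, ← map_mul, show p * (2 * z - p) = y by linear_combination -hp, hχyz]
      rw [hGc, sum_insert (by simp [hz.symm, h0y, a1, b1]),
        sum_insert (by simp [hzy, a2, b2]), sum_insert (by simp [a3, b3]),
        sum_insert (by simp [hpp]), sum_singleton, hχ, MulChar.map_zero]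
      rcases quadraticChar_dichotomy a1.symm with h | h <;>
      rcases quadraticChar_dichotomy b1.symm with h' | h' <;>
      rcases quadraticChar_dichotomy hz with h'' | h'' <;>
      · rw [h, h', h''] at hprod ⊢
        revert hprod
        decide
    · push Not at hfix
      have hGc : Gᶜ = {0, z, y / z} := by
        ext r
        have := hfix r
        simp only [mem_compl, hmem, mem_insert, mem_singleton, eq_div_iff hz]
        rw [mul_comm r z]
        tauto
      rw [hGc, sum_insert (by simp [hz.symm, h0y]), sum_insert (by simp [hzy]), sum_singleton,
        hχ, MulChar.map_zero]
      linarith [quadraticChar_le_one z]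
  have hsumG : 0 ≤ ∑ t ∈ G, χ t := by
    have := sum_add_sum_compl G (fun t => χ t)
    rw [quadraticChar_sum_zero hF] at this
    linarith
  have hnonneg : ∀ t ∈ G, 0 ≤ (1 - χ t) * (1 - χ (φ t)) := fun t _ =>
    mul_nonneg (sub_nonneg.2 (quadraticChar_le_one t)) (sub_nonneg.2 (quadraticChar_le_one _))
  -- By `hplus` and the invariance of `G`, this sum equals `-4 ∑ χ t ≤ 0`, so every nonnegative term
  -- vanishes.
  have hminus : ∑ t ∈ G, (1 - χ t) * (1 - χ (φ t)) = 0 := by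
    refine le_antisymm ?_ (sum_nonneg hnonneg)
    have h1 : ∑ t ∈ G, (1 - χ t) * (1 - χ (φ t)) =
        ∑ t ∈ G, ((1 + χ t) * (1 + χ (φ t)) - 2 * χ t - 2 * χ (φ t)) :=
      sum_congr rfl fun t _ => by ring
    rw [h1, sum_sub_distrib, sum_sub_distrib, sum_eq_zero hplus, ← mul_sum, ← mul_sum, hsumφ]
    linarith
  have htG : t ∈ G := (hmem t).2 ⟨ht0, hty, htz, htf⟩
  have e1 := hplus t htG
  have e2 := (sum_eq_zero_iff_of_nonneg hnonneg).1 hminus t htG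
  have e3 : χ (φ t) = χ ((z * t - y) * (t - z)) := quadraticChar_div _ _
  rw [mul_assoc, map_mul, ← e3]
  linarith

/-- For `y = -z²` the quadratic used in `exists_isSquare_pair` degenerates to a square multiple of
`z`. Here the cubic is `z t (t² - z²)`. If `-1 = i²`, its value at `z i` is a square, because `(i -
1)² = -2i`; otherwise its oddness contradicts a constant character at `t` and `-t`. -/
theorem exists_isSquare_pair_of_eq_neg_sq (hF : ringChar F ≠ 2) (hcard : 17 ≤ Fintype.card F)
    {z : F} (hz : z ≠ 0) :
    ∃ t s : F, IsSquare t ∧ IsSquare s ∧ t ≠ s ∧ t * s + -z ^ 2 = z * (t + s) := by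
  by_contra! hbad
  have h2 : (2 : F) ≠ 0 := Ring.two_ne_zero hF
  have hz2 : z ^ 2 ≠ 0 := pow_ne_zero 2 hz
  have hyz : -z ^ 2 ≠ z ^ 2 := fun h =>
    mul_ne_zero h2 hz2 (by linear_combination -h)
  have key : ∀ {t : F}, _ := fun {t} =>
    quadraticChar_cubic_eq_neg_one (t := t) hF (neg_ne_zero.2 hz2) hz hyz hbad
  by_cases hsq : IsSquare (-1 : F)
  · obtain ⟨i, hi⟩ := hsq
    have hi1 : i + 1 ≠ 0 := fun h => h2 (by linear_combination (1 - i) * h - hi)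
    have hi2 : i - 1 ≠ 0 := fun h => h2 (by linear_combination -(1 + i) * h - hi)
    have hi0 : i ≠ 0 := by
      rintro rfl
      simp at hi
    have h := key (t := z * i) (mul_ne_zero hz hi0)
      (fun h => mul_ne_zero hz2 hi1 (by linear_combination h))
      (fun h => mul_ne_zero hz hi2 (by linear_combination h))
      (fun h => mul_ne_zero (mul_ne_zero h2 hz2) hi1 (by linear_combination -h - z ^ 2 * hi))
    rw [show z * i * (z * (z * i) - -z ^ 2) * (z * i - z) = (z ^ 2 * (i - 1)) ^ 2 by
      linear_combination z ^ 4 * (1 - i) * hi,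
      quadraticChar_sq_one' (mul_ne_zero hz2 hi2)] at h
    norm_num at h
  · obtain ⟨t, ht⟩ : ∃ t, t ∉ ({0, z, -z} : Finset F) ∪
        ({t | 1 * t ^ 2 + -2 * z * t + -z ^ 2 = 0} : Finset F) ∪
        ({t | 1 * t ^ 2 + 2 * z * t + -z ^ 2 = 0} : Finset F) := by
      by_contra! hall
      have h1 := card_le_card (fun t _ => hall t : (univ : Finset F) ⊆ _)
      have h3 := (h1.trans (card_union_le _ _)).trans (Nat.add_le_add_right (card_union_le _ _) _)
      have := card_le_three (a := (0 : F)) (b := z) (c := -z)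
      have := card_quadratic_roots_le 1 (-2 * z) (-z ^ 2) one_ne_zero
      have := card_quadratic_roots_le 1 (2 * z) (-z ^ 2) one_ne_zero
      rw [card_univ] at h3
      omega
    simp only [mem_union, mem_insert, mem_singleton, mem_filter, mem_univ, true_and, not_or] at ht
    obtain ⟨⟨⟨ht0, htz, htz'⟩, hf1⟩, hf2⟩ := ht
    have e1 := key ht0 (fun h => htz' (mul_left_cancel₀ hz (by linear_combination h))) htz
      (fun h => hf1 (by linear_combination h))
    have e2 := key (t := -t) (neg_ne_zero.2 ht0)
      (fun h => htz (mul_left_cancel₀ hz (by linear_combination -h)))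
      (fun h => htz' (by linear_combination -h)) (fun h => hf2 (by linear_combination h))
    rw [show -t * (z * -t - -z ^ 2) * (-t - z) = -1 * (t * (z * t - -z ^ 2) * (t - z)) by ring,
      map_mul, e1, quadraticChar_neg_one_iff_not_isSquare.2 hsq] at e2
    norm_num at e2

theorem exists_isSquare_pair (hF : ringChar F ≠ 2) (hcard : 17 ≤ Fintype.card F)
    {y z : F} (hy : y ≠ 0) (hz : z ≠ 0) (hyz : y ≠ z ^ 2) :
    ∃ t s : F, IsSquare t ∧ IsSquare s ∧ t ≠ s ∧ t * s + y = z * (t + s) := by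
  by_cases hw : y + z ^ 2 = 0
  · rw [eq_neg_of_add_eq_zero_left hw]
    exact exists_isSquare_pair_of_eq_neg_sq hF hcard hz
  by_contra! hbad
  set χ := quadraticChar F
  have hyz' : z ^ 2 - y ≠ 0 := sub_ne_zero.2 hyz.symm
  have key : ∀ {t : F}, _ := fun {t} =>
    quadraticChar_cubic_eq_neg_one (t := t) hF hy hz hyz hbad
  set E : Finset F := {z, y / z, (y + z ^ 2) / z} ∪
    ({t | 1 * t ^ 2 + -2 * z * t + y = 0} : Finset F) ∪
    ({t | z ^ 2 * t ^ 2 + -2 * y * z * t + (y ^ 2 + y * z ^ 2 - z ^ 4) = 0} : Finset F) with hE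
  have hterm : ∀ t : F, t ≠ 0 → t ∉ E → χ (-z) * χ (t * (z * t + -(y + z ^ 2))) = 1 := by
    intro t ht0 ht
    simp only [hE, mem_union, mem_insert, mem_singleton, mem_filter, mem_univ, true_and,
      not_or] at ht
    obtain ⟨⟨⟨htz, hty, htw⟩, hf1⟩, hf2⟩ := ht
    rw [eq_div_iff hz] at hty htw
    have htz' := sub_ne_zero.2 htz
    have hty' : z * t - y ≠ 0 := fun h => hty (by linear_combination h)
    have htw' : z * t + -(y + z ^ 2) ≠ 0 := fun h => htw (by linear_combination h)
    -- The cubic branches at `0`, `y / z`, `z`, `∞`. Their preimages under `t ↦ t'` are `y / z`,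
    -- `∞`, `(y + z²) / z`, `z`, so in the product only `0` and `(y + z²) / z` survive modulo
    -- squares.
    set t' := y / z ^ 2 * ((z * t - y) / (t - z)) with ht'
    have e1 := key ht0 (fun h => hty (by linear_combination h)) htz
      (fun h => hf1 (by linear_combination h))
    have f1 : z * t' - y = y * (z ^ 2 - y) / (z * (t - z)) := by
      rw [ht']
      field_simp
      ring
    have f2 : t' - z = (y - z ^ 2) * (z * t + -(y + z ^ 2)) / (z ^ 2 * (t - z)) := by
      rw [ht']
      field_simp
      ring
    have f3 : t' ^ 2 - 2 * z * t' + y = y * (y - z ^ 2) *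
        (z ^ 2 * t ^ 2 + -2 * y * z * t + (y ^ 2 + y * z ^ 2 - z ^ 4)) / (z ^ 4 * (t - z) ^ 2) := by
      rw [ht']
      field_simp
      ring
    have hyz'' := sub_ne_zero.2 hyz
    have hz2 := pow_ne_zero 2 hz
    have e2 := key (t := t') (mul_ne_zero (div_ne_zero hy hz2) (div_ne_zero hty' htz'))
      (sub_ne_zero.1 (f1 ▸ div_ne_zero (mul_ne_zero hy hyz') (mul_ne_zero hz htz')))
      (sub_ne_zero.1 (f2 ▸ div_ne_zero (mul_ne_zero hyz'' htw') (mul_ne_zero hz2 htz')))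
      (f3 ▸ div_ne_zero (mul_ne_zero (mul_ne_zero hy hyz'') hf2)
        (mul_ne_zero (pow_ne_zero 4 hz) (pow_ne_zero 2 htz')))
    rw [f1, f2] at e2
    have hsq : y * (z ^ 2 - y) * (z * t - y) / (z ^ 3 * (t - z)) ≠ 0 :=
      div_ne_zero (mul_ne_zero (mul_ne_zero hy hyz') hty') (mul_ne_zero (pow_ne_zero 3 hz) htz')
    have hprod : t * (z * t - y) * (t - z) * (t' * (y * (z ^ 2 - y) / (z * (t - z))) *
        ((y - z ^ 2) * (z * t + -(y + z ^ 2)) / (z ^ 2 * (t - z)))) =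
        -z * (t * (z * t + -(y + z ^ 2))) *
          (y * (z ^ 2 - y) * (z * t - y) / (z ^ 3 * (t - z))) ^ 2 := by
      rw [ht']
      field_simp
      ring
    have := congrArg (quadraticChar F) hprod
    rw [map_mul, e1, e2, map_mul, quadraticChar_sq_one' hsq, mul_one, map_mul] at this
    rw [← this]
    norm_num
  -- `t = 0` contributes 1 and each of at most 7 elements of `E` at most 2. The sum is exactly `q +
  -- χ(-1) ≥ 16`.
  have hle : ∑ t : F, (1 - χ (-z) * χ (t * (z * t + -(y + z ^ 2)))) ≤ 15 := by
    have hb : ∀ t : F, 1 - χ (-z) * χ (t * (z * t + -(y + z ^ 2))) ≤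
        (if t = 0 then 1 else 0) + if t ∈ E then 2 else 0 := by
      intro t
      by_cases ht0 : t = 0
      · subst ht0
        rw [zero_mul, MulChar.map_zero, if_pos rfl]
        split_ifs <;> norm_num
      · by_cases ht : t ∈ E
        · simp only [ht0, ht, if_true, if_false]
          rw [← map_mul]
          linarith [neg_one_le_quadraticChar (-z * (t * (z * t + -(y + z ^ 2))))]
        · rw [hterm t ht0 ht]
          simp [ht0, ht]
    refine (sum_le_sum fun t _ => hb t).trans ?_
    have hEcard : #E ≤ 7 := by
      have h3 : #E ≤ _ := (card_union_le _ _).trans (Nat.add_le_add_right (card_union_le _ _) _)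
      have := card_le_three (a := z) (b := y / z) (c := (y + z ^ 2) / z)
      have := card_quadratic_roots_le 1 (-2 * z) y one_ne_zero
      have := card_quadratic_roots_le (z ^ 2) (-2 * y * z) (y ^ 2 + y * z ^ 2 - z ^ 4)
        (pow_ne_zero 2 hz)
      omega
    rw [sum_add_distrib]
    simp
    omega
  rw [sum_sub_distrib, ← mul_sum,
    sum_quadraticChar_mul_linear hF (neg_ne_zero.2 hw)] at hle
  have h1 : χ (-z) * -χ z = - χ (-1) := by
    rw [show -z = -1 * z by ring, map_mul, mul_neg, mul_assoc, ← sq, quadraticChar_sq_one hz,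
      mul_one]
  rw [h1] at hle
  simp at hle
  have := neg_one_le_quadraticChar (F := F) (-1)
  have : (17 : ℤ) ≤ Fintype.card F := by exact_mod_cast hcard
  linarith

theorem two_mul_card_isSquare (hF : ringChar F ≠ 2) :
    2 * #{t : F | IsSquare t} = Fintype.card F + 1 := by
  have hterm : ∀ t : F, 1 + quadraticChar F t =
      2 * (if IsSquare t then 1 else 0) - if t = 0 then 1 else 0 := by
    intro t
    by_cases ht : t = 0
    · simp [ht]
    · by_cases hs : IsSquare t
      · rw [(quadraticChar_one_iff_isSquare ht).2 hs]
        simp [ht, hs]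
      · rw [quadraticChar_neg_one_iff_not_isSquare.2 hs]
        simp [ht, hs]
  have h := Fintype.sum_congr _ _ hterm
  rw [sum_add_distrib, quadraticChar_sum_zero hF, sum_sub_distrib, ← mul_sum, sum_boole,
    sum_ite_eq' univ (0 : F)] at h
  simp only [sum_const, card_univ, nsmul_eq_mul, mul_one, add_zero, mem_univ, if_true] at h
  have : 2 * (#{t : F | IsSquare t} : ℤ) = Fintype.card F + 1 := by linarith
  exact_mod_cast this

end CharacterSums

end PlanarArc

namespace PlanarArc

/-! ### Lines through `(1, b, 0)`, the half conic, and the arc property -/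

section Geometry

variable {F : Type*} [Field F]

theorem exists_dotProduct_eq_zero_of_finrank_le {M : Submodule F (Fin 3 → F)}
    (hM : Module.finrank F M ≤ 2) : ∃ n : Fin 3 → F, n ≠ 0 ∧ ∀ v ∈ M, n ⬝ᵥ v = 0 := by
  have hlt : M < ⊤ := by
    rw [lt_top_iff_ne_top]
    rintro rfl
    simp at hM
  obtain ⟨f, hf, hle⟩ := M.exists_le_ker_of_lt_top hlt
  refine ⟨(dotProductEquiv F (Fin 3)).symm f, by simpa using hf, fun v hv => ?_⟩
  rw [← dotProductEquiv_apply_apply, LinearEquiv.apply_symm_apply]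
  exact hle hv

theorem finrank_ker_dotProductEquiv {n : Fin 3 → F} (hn : n ≠ 0) :
    Module.finrank F (LinearMap.ker (dotProductEquiv F (Fin 3) n)) = 2 := by
  have h := Module.Dual.finrank_ker_add_one_of_ne_zero
    (f := dotProductEquiv F (Fin 3) n) (by simpa using hn)
  simp at h
  exact h

/-- A line is the zero set of a nonzero linear form. -/
theorem IsLine.exists_mem_iff {l : Projectivization.Subspace F (Fin 3 → F)} (hl : IsLine l) :
    ∃ n : Fin 3 → F, n ≠ 0 ∧
      ∀ (v : Fin 3 → F) (hv : v ≠ 0), Projectivization.mk F v hv ∈ l ↔ n ⬝ᵥ v = 0 := by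
  obtain ⟨n, hn, h⟩ := exists_dotProduct_eq_zero_of_finrank_le hl.le
  refine ⟨n, hn, fun v hv => ?_⟩
  have heq : l.submodule = LinearMap.ker (dotProductEquiv F (Fin 3) n) := by
    refine Submodule.eq_of_le_of_finrank_eq (fun v hv => ?_) ?_
    · simpa using h v hv
    · rw [finrank_ker_dotProductEquiv hn]
      exact hl
  rw [← Projectivization.Subspace.mem_submodule_iff l hv, heq]
  simp

/-- A line containing the three points is a nonzero normal vector in the kernel of the matrix with
these rows. -/
theorem isCollinear_mk_iff {u v w : Fin 3 → F} (hu : u ≠ 0) (hv : v ≠ 0) (hw : w ≠ 0) :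
    Projectivization.IsCollinear ({Projectivization.mk F u hu, Projectivization.mk F v hv,
      Projectivization.mk F w hw} : Set (PG2 F)) ↔ Matrix.det (Matrix.of ![u, v, w]) = 0 := by
  have hvec : ∀ n : Fin 3 → F, Matrix.mulVec (Matrix.of ![u, v, w]) n = 0 ↔
      n ⬝ᵥ u = 0 ∧ n ⬝ᵥ v = 0 ∧ n ⬝ᵥ w = 0 := by
    intro n
    rw [funext_iff, Fin.forall_fin_succ, Fin.forall_fin_succ, Fin.forall_fin_succ]
    simp [Matrix.mulVec, dotProduct_comm n]
  rw [← Matrix.exists_mulVec_eq_zero_iff]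
  simp_rw [hvec]
  constructor
  · rintro ⟨M, -, hM, hsub⟩
    obtain ⟨n, hn, h⟩ := exists_dotProduct_eq_zero_of_finrank_le hM
    have hmem : ∀ (x : Fin 3 → F) (hx : x ≠ 0), Projectivization.mk F x hx ∈ M → n ⬝ᵥ x = 0 :=
      fun x hx hxM => h x ((Projectivization.Subspace.mem_submodule_iff M hx).2 hxM)
    exact ⟨n, hn, hmem u hu (hsub (by simp)), hmem v hv (hsub (by simp)),
      hmem w hw (hsub (by simp))⟩
  · rintro ⟨n, hn, h1, h2, h3⟩
    refine ⟨(LinearMap.ker (dotProductEquiv F (Fin 3) n)).projectivization, inferInstance, ?_, ?_⟩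
    · rw [Projectivization.Subspace.submodule.apply_symm_apply, finrank_ker_dotProductEquiv hn]
    · rintro P (rfl | rfl | rfl) <;> simpa

/-- The point `(1, t², t)` of the conic. -/
def conicPoint (t : F) : PG2 F :=
  Projectivization.mk F ![1, t ^ 2, t] (fun h => one_ne_zero (congrFun h 0))

/-- The point `(0, 1, 0)` of the conic. -/
def conicInfinity (F : Type*) [Field F] : PG2 F :=
  Projectivization.mk F ![0, 1, 0] (fun h => one_ne_zero (congrFun h 1))

/-- The point `(1, b, 0)`. -/
def axisPoint (b : F) : PG2 F :=
  Projectivization.mk F ![1, b, 0] (fun h => one_ne_zero (congrFun h 0))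

theorem conicPoint_injective : Function.Injective (conicPoint (F := F)) := by
  intro t s h
  rw [conicPoint, conicPoint, Projectivization.mk_eq_mk_iff'] at h
  obtain ⟨a, ha⟩ := h
  have h0 := congrFun ha 0
  have h2 := congrFun ha 2
  simp at h0 h2
  rw [← h2, h0, one_mul]

theorem conicPoint_ne_conicInfinity (t : F) : conicPoint t ≠ conicInfinity F := by
  intro h
  rw [conicPoint, conicInfinity, Projectivization.mk_eq_mk_iff'] at h
  obtain ⟨a, ha⟩ := h
  simpa using congrFun ha 0

theorem halfConic_eq_image : halfConic F = conicPoint '' {t : F | IsSquare t} := by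
  ext P
  constructor
  · rintro ⟨s, rfl⟩
    refine ⟨s ^ 2, IsSquare.sq s, ?_⟩
    simp only [conicPoint, halfConicPoint]
    congr 2
    ring_nf
  · rintro ⟨_, ⟨s, rfl⟩, rfl⟩
    refine ⟨s, ?_⟩
    simp only [conicPoint, halfConicPoint]
    congr 2
    ring_nf

theorem conicPoint_mem_halfConic_iff {t : F} : conicPoint t ∈ halfConic F ↔ IsSquare t := by
  rw [halfConic_eq_image, conicPoint_injective.mem_set_image, Set.mem_ofPred_eq]

theorem conicInfinity_notMem_halfConic : conicInfinity F ∉ halfConic F := by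
  rw [halfConic_eq_image]
  rintro ⟨t, -, h⟩
  exact conicPoint_ne_conicInfinity t h

theorem mem_conic_iff {P : PG2 F} :
    P ∈ conic F ↔ P = conicInfinity F ∨ ∃ t : F, P = conicPoint t := by
  constructor
  · rintro ⟨v, hv, rfl, h⟩
    by_cases h0 : v 0 = 0
    · left
      have h2 : v 2 = 0 := by
        rw [h0, zero_mul] at h
        exact pow_eq_zero_iff two_ne_zero |>.1 h.symm
      rw [conicInfinity, Projectivization.mk_eq_mk_iff']
      refine ⟨v 1, ?_⟩
      ext i
      fin_cases i <;> simp [h0, h2]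
    · right
      refine ⟨v 2 / v 0, ?_⟩
      rw [conicPoint, Projectivization.mk_eq_mk_iff']
      refine ⟨v 0, ?_⟩
      ext i
      fin_cases i
      · simp
      · simp
        field_simp
        exact h.symm
      · simp
        field_simp
  · rintro (rfl | ⟨t, rfl⟩)
    · exact ⟨_, _, rfl, by simp⟩
    · exact ⟨_, _, rfl, by simp⟩

theorem halfConic_subset_conic : halfConic F ⊆ conic F := by
  rw [halfConic_eq_image]
  rintro _ ⟨t, -, rfl⟩
  exact mem_conic_iff.2 (Or.inr ⟨t, rfl⟩)

theorem axisPoint_notMem_conic {b : F} (hb : ¬ IsSquare (-b)) : axisPoint b ∉ conic F := by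
  rw [mem_conic_iff]
  rintro (h | ⟨t, h⟩)
  · rw [axisPoint, conicInfinity, Projectivization.mk_eq_mk_iff'] at h
    obtain ⟨a, ha⟩ := h
    simpa using congrFun ha 0
  · rw [axisPoint, conicPoint, Projectivization.mk_eq_mk_iff'] at h
    obtain ⟨a, ha⟩ := h
    have h0 := congrFun ha 0
    have h1 := congrFun ha 1
    have h2 := congrFun ha 2
    simp at h0 h1 h2
    subst h0
    simp at h2
    subst h2
    apply hb
    simp [← h1]

/-- Description of the lines through `(1, b, 0)` by their intersection with the conic. -/
theorem IsLine.conic_inter_of_axisPoint_mem {l : Projectivization.Subspace F (Fin 3 → F)}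
    (hl : IsLine l) {b : F} (h : axisPoint b ∈ l) :
    (conicInfinity F ∈ l ∧ ∀ t : F, conicPoint t ∈ l ↔ t = 0) ∨
    (conicInfinity F ∉ l ∧ ∃ m : F, ∀ t : F, conicPoint t ∈ l ↔ t ^ 2 + m * t - b = 0) := by
  obtain ⟨n, hn, hmem⟩ := hl.exists_mem_iff
  rw [axisPoint, hmem] at h
  simp_rw [conicInfinity, conicPoint, hmem]
  simp only [dotProduct, Fin.sum_univ_three] at h ⊢
  simp at h ⊢
  by_cases h1 : n 1 = 0
  · left
    have h0 : n 0 = 0 := by simpa [h1] using h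
    have h2 : n 2 ≠ 0 := by
      intro h2
      apply hn
      ext i
      fin_cases i <;> simp [h0, h1, h2]
    simp [h0, h1, h2]
  · right
    refine ⟨h1, n 2 / n 1, fun t => ?_⟩
    have : n 0 + n 1 * t ^ 2 + n 2 * t = n 1 * (t ^ 2 + n 2 / n 1 * t - b) := by
      field_simp
      linear_combination h
    rw [this, mul_eq_zero, or_iff_right h1]

/-- By Vieta the two roots multiply to the non-square `-b`, so exactly one of them is a square. -/
theorem exists_isSquare_root_and_not_isSquare_root [Fintype F] {b m : F} (hb : ¬ IsSquare (-b)) {t : F}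
    (ht : t ^ 2 + m * t - b = 0) :
    ∃ r s : F, r ≠ s ∧ IsSquare r ∧ ¬ IsSquare s ∧
      ∀ x : F, x ^ 2 + m * x - b = 0 ↔ x = r ∨ x = s := by
  classical
  have hroots : ∀ x : F, x ^ 2 + m * x - b = 0 ↔ x = t ∨ x = -m - t := by
    intro x
    rw [← sub_eq_zero (b := t), ← sub_eq_zero (b := -m - t), ← mul_eq_zero]
    constructor <;> intro h
    · linear_combination h - ht
    · linear_combination h + ht
  have hprod : t * (-m - t) = -b := by linear_combination -ht
  have hχ := quadraticChar_neg_one_iff_not_isSquare.2 hb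
  rw [← hprod, map_mul] at hχ
  by_cases hs : IsSquare t
  · have hs' : ¬ IsSquare (-m - t) := fun h => hb (hprod ▸ hs.mul h)
    exact ⟨t, -m - t, fun h => hs' (h ▸ hs), hs, hs', hroots⟩
  · have hs' : IsSquare (-m - t) := by
      rw [quadraticChar_neg_one_iff_not_isSquare.2 hs] at hχ
      exact isSquare_of_quadraticChar_eq_one (by linarith)
    exact ⟨-m - t, t, fun h => hs (h ▸ hs'), hs', hs, fun x => (hroots x).trans or_comm⟩

/-- A line through `(1, b, 0)` that meets the conic has exactly two points on it, one of which
lies in the half conic. -/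
theorem IsLine.exists_conic_inter_eq [Fintype F] {l : Projectivization.Subspace F (Fin 3 → F)}
    (hl : IsLine l) {b : F} (hb : ¬ IsSquare (-b)) (h : axisPoint b ∈ l)
    (hne : ((l : Set (PG2 F)) ∩ conic F).Nonempty) :
    ∃ P Q : PG2 F, P ≠ Q ∧ P ∈ halfConic F ∧ Q ∉ halfConic F ∧
      (l : Set (PG2 F)) ∩ conic F = {P, Q} := by
  rcases hl.conic_inter_of_axisPoint_mem h with ⟨h1, h2⟩ | ⟨h1, m, h2⟩
  · refine ⟨conicPoint 0, conicInfinity F, conicPoint_ne_conicInfinity 0,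
      conicPoint_mem_halfConic_iff.2 IsSquare.zero, conicInfinity_notMem_halfConic, ?_⟩
    ext P
    rw [Set.mem_inter_iff, mem_conic_iff, SetLike.mem_coe]
    constructor
    · rintro ⟨hP, rfl | ⟨t, rfl⟩⟩
      · simp
      · simp [(h2 t).1 hP]
    · rintro (rfl | rfl)
      · exact ⟨(h2 0).2 rfl, Or.inr ⟨0, rfl⟩⟩
      · exact ⟨h1, Or.inl rfl⟩
  · obtain ⟨P, hPl, hPC⟩ := hne
    rw [mem_conic_iff] at hPC
    rcases hPC with rfl | ⟨t, rfl⟩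
    · exact absurd hPl h1
    obtain ⟨r, s, hrs, hr, hs, hroots⟩ := exists_isSquare_root_and_not_isSquare_root hb ((h2 t).1 hPl)
    refine ⟨conicPoint r, conicPoint s, conicPoint_injective.ne hrs,
      conicPoint_mem_halfConic_iff.2 hr, mt conicPoint_mem_halfConic_iff.1 hs, ?_⟩
    ext P
    rw [Set.mem_inter_iff, mem_conic_iff, SetLike.mem_coe]
    constructor
    · rintro ⟨hP, rfl | ⟨t, rfl⟩⟩
      · exact absurd hP h1
      · rcases (hroots t).1 ((h2 t).1 hP) with rfl | rfl <;> simp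
    · rintro (rfl | rfl)
      · exact ⟨(h2 _).2 ((hroots _).2 (Or.inl rfl)), Or.inr ⟨_, rfl⟩⟩
      · exact ⟨(h2 _).2 ((hroots _).2 (Or.inr rfl)), Or.inr ⟨_, rfl⟩⟩

theorem isInternalPoint_axisPoint [Fintype F] {b : F} (hb : ¬ IsSquare (-b)) :
    IsInternalPoint (conic F) (axisPoint b) := by
  refine ⟨axisPoint_notMem_conic hb, fun l ⟨hl, hcard⟩ h => ?_⟩
  obtain ⟨P, Q, hPQ, -, -, heq⟩ := hl.exists_conic_inter_eq hb h
    (Set.nonempty_of_ncard_ne_zero (by omega))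
  rw [heq, Set.ncard_pair hPQ] at hcard
  omega

theorem ncard_secant_inter_halfConic [Fintype F] {b : F} (hb : ¬ IsSquare (-b))
    {l : Projectivization.Subspace F (Fin 3 → F)} (hl : IsSecantLine (conic F) l)
    (h : axisPoint b ∈ l) : ((l : Set (PG2 F)) ∩ halfConic F).ncard = 1 := by
  obtain ⟨hl, hcard⟩ := hl
  obtain ⟨P, Q, -, hP, hQ, heq⟩ := hl.exists_conic_inter_eq hb h
    (Set.nonempty_of_ncard_ne_zero (by omega))
  rw [Set.ncard_eq_one]
  refine ⟨P, ?_⟩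
  rw [← Set.inter_eq_self_of_subset_right halfConic_subset_conic, ← Set.inter_assoc, heq]
  ext X
  simp only [Set.mem_inter_iff, Set.mem_insert_iff, Set.mem_singleton_iff]
  constructor
  · rintro ⟨rfl | rfl, hX⟩
    · rfl
    · exact absurd hX hQ
  · rintro rfl
    exact ⟨Or.inl rfl, hP⟩

theorem ncard_halfConic [Fintype F] (hF : ringChar F ≠ 2) :
    (halfConic F).ncard = (Fintype.card F + 1) / 2 := by
  classical
  rw [halfConic_eq_image, Set.ncard_image_of_injective _ conicPoint_injective,
    ← two_mul_card_isSquare hF, Nat.mul_div_cancel_left _ two_pos, ← Set.ncard_coe_finset]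
  simp

theorem isArc_halfConic_union {b : F} (hb : ¬ IsSquare (-b)) :
    IsArc (halfConic F ∪ {axisPoint b}) := by
  have hprod : ∀ t s : F, IsSquare t → IsSquare s → t * s + b ≠ 0 := fun t s ht hs h =>
    hb (by rw [← eq_neg_of_add_eq_zero_left h]; exact ht.mul hs)
  rw [halfConic_eq_image]
  have hsub : ∀ {t s : F}, conicPoint t ≠ conicPoint s → t - s ≠ 0 := fun h =>
    sub_ne_zero.2 fun h' => h (congrArg _ h')
  rintro P (⟨t, ht, rfl⟩ | rfl) Q (⟨s, hs, rfl⟩ | rfl) R (⟨r, hr, rfl⟩ | rfl) hPQ hPR hQR <;>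
    first | exact absurd rfl hPQ | exact absurd rfl hPR | exact absurd rfl hQR | skip
  -- The determinant is a Vandermonde product for three conic points and `±(t - s)(t s + b)` for two
  -- of them with `(1, b, 0)`.
  all_goals
    simp only [conicPoint, axisPoint]
    rw [isCollinear_mk_iff, Matrix.det_fin_three]
    simp
    intro h
  · exact mul_ne_zero (mul_ne_zero (hsub hPQ) (hsub hPR)) (hsub hQR) (by linear_combination h)
  · exact mul_ne_zero (hsub hPQ) (hprod t s ht hs) (by linear_combination h)
  · exact mul_ne_zero (hsub hPR) (hprod t r ht hr) (by linear_combination -h)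
  · exact mul_ne_zero (hsub hQR) (hprod s r hs hr) (by linear_combination h)

end Geometry

end PlanarArc

namespace PlanarArc

/-! ### Completeness of the arc -/

section Completeness

variable {F : Type*} [Field F]

theorem isCollinear_mk_conicPoint_conicPoint {v : Fin 3 → F} (hv : v ≠ 0) {t s : F}
    (h : v 0 * (t * s) + v 1 = v 2 * (t + s)) :
    Projectivization.IsCollinear
      ({Projectivization.mk F v hv, conicPoint t, conicPoint s} : Set (PG2 F)) := by
  rw [conicPoint, conicPoint, isCollinear_mk_iff, Matrix.det_fin_three]
  simp
  linear_combination (t - s) * h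

theorem isCollinear_mk_conicPoint_axisPoint {v : Fin 3 → F} (hv : v ≠ 0) {t b : F}
    (h : v 0 * (b * t) - v 1 * t = v 2 * (b - t ^ 2)) :
    Projectivization.IsCollinear
      ({Projectivization.mk F v hv, conicPoint t, axisPoint b} : Set (PG2 F)) := by
  rw [conicPoint, axisPoint, isCollinear_mk_iff, Matrix.det_fin_three]
  simp
  linear_combination -h

variable [Fintype F]

/-- Every point off the conic and off the line `Z = 0`, except `(0, 0, 1)`, lies on a secant of the
half conic. -/
theorem exists_isSquare_pair_homogeneous (hF : ringChar F ≠ 2) (hcard : 17 ≤ Fintype.card F)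
    {x y z : F} (hz : z ≠ 0) (hxy : x * y ≠ z ^ 2) (h0 : x ≠ 0 ∨ y ≠ 0) :
    ∃ t s : F, IsSquare t ∧ IsSquare s ∧ t ≠ s ∧ x * (t * s) + y = z * (t + s) := by
  classical
  by_cases hx : x = 0
  · have hy : y ≠ 0 := h0.resolve_left fun h => h hx
    obtain ⟨t, s, ht, hs, -, -, hne, h⟩ := exists_isSquare_add_eq hF hcard (div_ne_zero hy hz)
    refine ⟨t, s, ht, hs, hne, ?_⟩
    rw [h, hx]
    field_simp
    ring
  -- With `y = 0` the chord equation says that `t⁻¹ + s⁻¹ = x / z`.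
  by_cases hy : y = 0
  · obtain ⟨t, s, ht, hs, ht0, hs0, hne, h⟩ :=
      exists_isSquare_add_eq hF hcard (div_ne_zero hx hz)
    refine ⟨t⁻¹, s⁻¹, ht.inv, hs.inv, inv_injective.ne hne, ?_⟩
    rw [hy]
    field_simp at h ⊢
    linear_combination -h
  obtain ⟨t, s, ht, hs, hne, h⟩ := exists_isSquare_pair (y := y / x) (z := z / x) hF hcard
    (div_ne_zero hy hx) (div_ne_zero hz hx) (by
      intro h
      field_simp at h
      exact hxy (by linear_combination h))
  refine ⟨t, s, ht, hs, hne, ?_⟩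
  field_simp at h
  linear_combination h

theorem isSquare_mul_of_not_isSquare {a b : F} (ha : ¬ IsSquare a) (hb : ¬ IsSquare b) :
    IsSquare (a * b) := by
  classical
  apply isSquare_of_quadraticChar_eq_one
  rw [map_mul, quadraticChar_neg_one_iff_not_isSquare.2 ha,
    quadraticChar_neg_one_iff_not_isSquare.2 hb]
  norm_num

theorem exists_isCollinear_of_notMem (hF : ringChar F ≠ 2) (hcard : 17 ≤ Fintype.card F)
    {b : F} (hb : ¬ IsSquare (-b)) {P : PG2 F} (hP : P ∉ halfConic F ∪ {axisPoint b}) :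
    ∃ Q ∈ halfConic F ∪ {axisPoint b}, ∃ R ∈ halfConic F ∪ {axisPoint b}, Q ≠ R ∧
      Projectivization.IsCollinear ({P, Q, R} : Set (PG2 F)) := by
  have hPH : P ∉ halfConic F := fun h => hP (Or.inl h)
  have hmem : ∀ {t : F}, IsSquare t → conicPoint t ∈ halfConic F ∪ {axisPoint b} := fun ht =>
    Or.inl (conicPoint_mem_halfConic_iff.2 ht)
  have haxis : axisPoint b ∈ halfConic F ∪ {axisPoint b} := Or.inr rfl
  have hne : ∀ t : F, conicPoint t ≠ axisPoint b := fun t h =>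
    axisPoint_notMem_conic hb (h ▸ mem_conic_iff.2 (Or.inr ⟨t, rfl⟩))
  by_cases hC : P ∈ conic F
  · rcases mem_conic_iff.1 hC with rfl | ⟨t, rfl⟩
    · refine ⟨_, hmem IsSquare.zero, _, haxis, hne 0, ?_⟩
      exact isCollinear_mk_conicPoint_axisPoint _ (by simp)
    · have ht : ¬ IsSquare t := fun h => hPH (conicPoint_mem_halfConic_iff.2 h)
      have ht0 : t ≠ 0 := by
        rintro rfl
        exact ht IsSquare.zero
      -- `-b / t` is the second intersection of the conic with the line joining `t` to `(1, b, 0)`.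
      have hs : IsSquare (-b / t) := by
        rw [div_eq_mul_inv]
        exact isSquare_mul_of_not_isSquare hb (by rwa [isSquare_inv])
      refine ⟨_, hmem hs, _, haxis, hne _, ?_⟩
      refine isCollinear_mk_conicPoint_axisPoint _ ?_
      simp
      field_simp
      ring
  · induction P using Projectivization.ind with | h v hv =>
    have hv' : v 0 * v 1 ≠ v 2 ^ 2 := fun h => hC ⟨v, hv, rfl, h⟩
    by_cases hz : v 2 = 0
    · exact ⟨_, hmem IsSquare.zero, _, haxis, hne 0,
        isCollinear_mk_conicPoint_axisPoint _ (by simp [hz])⟩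
    by_cases h0 : v 0 ≠ 0 ∨ v 1 ≠ 0
    · obtain ⟨t, s, ht, hs, hts, h⟩ := exists_isSquare_pair_homogeneous hF hcard hz hv' h0
      exact ⟨_, hmem ht, _, hmem hs, conicPoint_injective.ne hts,
        isCollinear_mk_conicPoint_conicPoint hv h⟩
    push Not at h0
    obtain ⟨hx, hy⟩ := h0
    -- Only `(0, 0, 1)` remains. It lies on the chord `1`, `-1` if `-1` is a square; otherwise `b =
    -- r²` with `r` a square, and it is collinear with `(1, r², r)` and `(1, b, 0)`.
    by_cases hi : IsSquare (-1 : F)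
    · refine ⟨_, hmem IsSquare.one, _, hmem hi, conicPoint_injective.ne fun h => ?_,
        isCollinear_mk_conicPoint_conicPoint hv (by simp [hx, hy])⟩
      exact Ring.two_ne_zero hF (by linear_combination h)
    · obtain ⟨w, hw⟩ := isSquare_mul_of_not_isSquare hi hb
      rw [neg_one_mul, neg_neg] at hw
      obtain ⟨r, hr, hrb⟩ : ∃ r : F, IsSquare r ∧ r ^ 2 = b := by
        by_cases hs : IsSquare w
        · exact ⟨w, hs, by rw [hw, sq]⟩
        · refine ⟨-1 * w, isSquare_mul_of_not_isSquare hi hs, ?_⟩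
          rw [hw]
          ring
      exact ⟨_, hmem hr, _, haxis, hne r,
        isCollinear_mk_conicPoint_axisPoint hv (by simp [hx, hy, hrb])⟩

theorem isCompleteArc_halfConic_union (hF : ringChar F ≠ 2) (hcard : 17 ≤ Fintype.card F)
    {b : F} (hb : ¬ IsSquare (-b)) : IsCompleteArc (halfConic F ∪ {axisPoint b}) := by
  refine ⟨isArc_halfConic_union hb, fun K hK hsub P hPK => ?_⟩
  by_contra hP
  obtain ⟨Q, hQ, R, hR, hQR, hcol⟩ := exists_isCollinear_of_notMem hF hcard hb hP
  exact hK P hPK Q (hsub hQ) R (hsub hR) (fun h => hP (h ▸ hQ)) (fun h => hP (h ▸ hR)) hQR hcol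

end Completeness

end PlanarArc

theorem mainTheorem1 {F : Type*} [Field F] [Fintype F] (q : ℕ) (hq : Fintype.card F = q)
    (hodd : Odd q) (hq17 : 17 ≤ q) (a₀ b₀ : F) (hR : (![a₀, b₀, 0] : Fin 3 → F) ≠ 0)
    (h1 : q % 4 = 1 → ¬ IsSquare (a₀ * b₀))
    (h3 : q % 4 = 3 → ∃ u : F, u ≠ 0 ∧ b₀ / a₀ = u ^ 4)
    (R₀ : PlanarArc.PG2 F) (hR₀ : R₀ = Projectivization.mk F ![a₀, b₀, 0] hR) :
    PlanarArc.halfConic F ⊆ PlanarArc.conic F ∧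
    (PlanarArc.halfConic F).ncard = (q + 1) / 2 ∧
    PlanarArc.IsInternalPoint (PlanarArc.conic F) R₀ ∧
    (∀ l : Projectivization.Subspace F (Fin 3 → F),
      PlanarArc.IsSecantLine (PlanarArc.conic F) l → R₀ ∈ l →
        ((l : Set (PlanarArc.PG2 F)) ∩ PlanarArc.halfConic F).ncard = 1) ∧
    (PlanarArc.halfConic F ∪ {R₀}).ncard = (q + 3) / 2 ∧
    PlanarArc.IsCompleteArc (PlanarArc.halfConic F ∪ {R₀}) := by
  subst hq
  have hF : ringChar F ≠ 2 := fun h => by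
    have := FiniteField.even_card_of_char_two h
    rw [Nat.odd_iff] at hodd
    omega
  -- The two congruence cases merge here, as `-1` is a square exactly when `q % 4 ≠ 3`.
  have key : a₀ ≠ 0 ∧ ¬ IsSquare (-(b₀ / a₀)) := by
    have hneg := FiniteField.isSquare_neg_one_iff (F := F)
    rcases Nat.odd_mod_four_iff.1 (Nat.odd_iff.1 hodd) with h | h
    · have ha : a₀ ≠ 0 := by
        rintro rfl
        exact h1 h (by simp)
      refine ⟨ha, fun hs => h1 h ?_⟩
      have hs' := ((hneg.2 (by omega)).mul hs).mul (IsSquare.sq a₀)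
      rwa [show -1 * -(b₀ / a₀) * a₀ ^ 2 = a₀ * b₀ by field_simp] at hs'
    · obtain ⟨u, hu, hub⟩ := h3 h
      refine ⟨?_, fun hs => ?_⟩
      · rintro rfl
        rw [div_zero, eq_comm] at hub
        exact pow_ne_zero 4 hu hub
      · refine hneg.1 ?_ h
        have hs' := hs.div (IsSquare.sq (u ^ 2))
        rwa [hub, show -u ^ 4 / (u ^ 2) ^ 2 = (-1 : F) by field_simp] at hs'
  obtain ⟨ha, hb⟩ := key
  have hR₀' : R₀ = PlanarArc.axisPoint (b₀ / a₀) := by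
    rw [hR₀, PlanarArc.axisPoint, Projectivization.mk_eq_mk_iff']
    refine ⟨a₀, ?_⟩
    ext i
    fin_cases i <;> simp [mul_div_cancel₀ _ ha]
  rw [hR₀']
  refine ⟨PlanarArc.halfConic_subset_conic, PlanarArc.ncard_halfConic hF,
    PlanarArc.isInternalPoint_axisPoint hb, fun l => PlanarArc.ncard_secant_inter_halfConic hb, ?_,
    PlanarArc.isCompleteArc_halfConic_union hF hq17 hb⟩
  rw [Set.union_singleton, Set.ncard_insert_of_notMem
    (fun h => PlanarArc.axisPoint_notMem_conic hb (PlanarArc.halfConic_subset_conic h))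
    (Set.finite_range _), PlanarArc.ncard_halfConic hF]
  omega
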